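/- Let $n\ge 0$ be an integer and let $\lambda_0<\lambda_1<\dots<\lambda_n$ be real numbers. Let $M_{\mathrm{St}_n,\lambda}$ be the set of Hermitian $(n+1)\times(n+1)$ matrices $A=(a_{ij})_{0\le i,j\le n}$ with spectrum $\{\lambda_0,\dots,\lambda_n\}$ that are arrow matrices, i.e. $a_{ij}=0$ whenever $i\ne j$, $i\neq 0$ and $j\neq 0$. Let $M^{\mathbb R}_{\mathrm{St}_n,\lambda}$ be the set of real symmetric matrices with the same properties. The group $T^{n+1}$ of diagonal unitary matrices acts on $M_{\mathrm{St}_n,\lambda}$ by conjugation $A\mapsto DAD^{-1}$. Scalar matrices act trivially, so $T^n\cong T^{n+1}/\Delta(T^1)$ acts, where $\Delta(T^1)$ is the subgroup of scalar matrices. In the same way $\mathbb Z_2^n\cong\{\pm1\}^{n+1}/\{\pm(1,\dots,1)\}$ acts on $M^{\mathbb R}_{\mathrm{St}_n,\lambda}$ by conjugation with diagonal matrices with entries $\pm1$. Then: (1) $M_{\mathrm{St}_n,\lambda}$ is a smooth manifold of dimension $2n$, namely a smooth embedded submanifold of the real vector space of complex $(n+1)\times(n+1)$ matrices, and the action of $T^n$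 on it is locally standard: every point has a $T^n$-invariant open neighbourhood $U$, a diffeomorphism $\varphi$ from $U$ onto an open subset of $\mathbb C^n$ that is invariant under the standard coordinatewise action of $T^n=\{(t_1,\dots,t_n)\in\mathbb C^n : |t_i|=1\}$, and an isomorphism of topological groups $\psi\colon T^{n+1}/\Delta(T^1)\to T^n$ such that $\varphi(g\cdot x)=\psi(g)\cdot\varphi(x)$ for all $g\in T^{n+1}/\Delta(T^1)$ and $x\in U$. (2) $M^{\mathbb R}_{\mathrm{St}_n,\lambda}$ is a smooth manifold of dimension $n$, namely a smooth embedded submanifold of the vector space of real $(n+1)\times(n+1)$ matrices, and the action of $\mathbb Z_2^n$ on it is locally standard: every point has an invariant open neighbourhood $U$, a diffeomorphism $\varphi$ from $U$ onto an open subset of $\mathbb R^n$ that is invariant under coordinatewise sign changes, and an isomorphism $\psi\colon\{\pm1\}^{n+1}/\{\pm(1,\dots,1)\}\to\{\pm1\}^n$ such that $\varphi(g\cdot x)=\psi(g)\cdot\varphi(x)$ for all $g\in\{\pm1\}^{n+1}/\{\pm(1,\dots,1)\}$ and $x\in U$. -/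

import Mathlib

open scoped Manifold ContDiff Matrix

/-!
The Hermitian (`𝕜 = ℂ`) and the real symmetric (`𝕜 = ℝ`) cases are treated uniformly over
`RCLike 𝕜`. Rows and columns are indexed by `0, 1, …, n`, that is by `Fin (n + 1)`.
-/

/-- The set of Hermitian arrow matrices of size `n + 1` (real symmetric ones if `𝕜 = ℝ`), with
nonzero entries only on the diagonal, in the first row and in the first column,
whose spectrum is `{lam 0, …, lam n}`. If the `lam i` are distinct, then these are `n + 1`
different eigenvalues, and each of them is simple. -/
def isospectralArrow (𝕜 : Type*) [RCLike 𝕜] {n : ℕ} (lam : Fin (n + 1) → ℝ) :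
    Set (Matrix (Fin (n + 1)) (Fin (n + 1)) 𝕜) :=
  {A | A.IsHermitian ∧ (∀ i j, i ≠ j → i ≠ 0 → j ≠ 0 → A i j = 0) ∧
    spectrum 𝕜 A = Set.range (fun i => (lam i : 𝕜))}

/-- `unitary ℂ` is the circle of complex numbers of modulus one. -/
theorem mem_unitary_complex_iff (z : ℂ) : z ∈ unitary ℂ ↔ ‖z‖ = 1 := by
  rw [Unitary.mem_iff_star_mul_self, RCLike.star_def, Complex.conj_mul',
    ← pow_eq_one_iff_of_nonneg (norm_nonneg z) two_ne_zero]
  norm_cast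

/-- `unitary ℝ` is the two-element group `{1, -1}`. -/
theorem mem_unitary_real_iff (x : ℝ) : x ∈ unitary ℝ ↔ x = 1 ∨ x = -1 := by
  rw [Unitary.mem_iff_star_mul_self, star_trivial, mul_self_eq_one_iff]

/-- The diagonal subgroup `{(t, …, t)}` of `(unitary 𝕜) ^ (n + 1)`. -/
def diagonalSubgroup (𝕜 : Type*) [RCLike 𝕜] (n : ℕ) : Subgroup (Fin (n + 1) → unitary 𝕜) :=
  (Pi.constMonoidHom (Fin (n + 1)) (unitary 𝕜)).range

/-- The group of diagonal unitary matrices of size `n + 1` modulo the scalar ones, with the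
quotient topology: `T ^ (n + 1) / Δ(T ^ 1) ≅ T ^ n` for `𝕜 = ℂ` and
`ℤ₂ ^ (n + 1) / Δ(ℤ₂) ≅ ℤ₂ ^ n` for `𝕜 = ℝ`. -/
abbrev ReducedTorus (𝕜 : Type*) [RCLike 𝕜] (n : ℕ) : Type _ :=
  (Fin (n + 1) → unitary 𝕜) ⧸ diagonalSubgroup 𝕜 n

/-- The diagonal matrix `diag(t_0, …, t_n)`. -/
def diagMatrix {𝕜 : Type*} [RCLike 𝕜] {n : ℕ} (t : Fin (n + 1) → unitary 𝕜) :
    Matrix (Fin (n + 1)) (Fin (n + 1)) 𝕜 :=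
  Matrix.diagonal fun i => ((t i : unitary 𝕜) : 𝕜)

theorem diagMatrix_mul {𝕜 : Type*} [RCLike 𝕜] {n : ℕ} (s t : Fin (n + 1) → unitary 𝕜) :
    diagMatrix (s * t) = diagMatrix s * diagMatrix t := by
  simp [diagMatrix, Matrix.diagonal_mul_diagonal]

theorem diagMatrix_one {𝕜 : Type*} [RCLike 𝕜] {n : ℕ} :
    diagMatrix (1 : Fin (n + 1) → unitary 𝕜) = 1 := by
  simp [diagMatrix]

theorem diagMatrix_conj_apply {𝕜 : Type*} [RCLike 𝕜] {n : ℕ} (t : Fin (n + 1) → unitary 𝕜)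
    (A : Matrix (Fin (n + 1)) (Fin (n + 1)) 𝕜) (i j : Fin (n + 1)) :
    (diagMatrix t * A * diagMatrix t⁻¹) i j = (t i : 𝕜) * A i j * star (t j : 𝕜) := by
  rw [diagMatrix, diagMatrix, Matrix.mul_diagonal, Matrix.diagonal_mul, Pi.inv_apply,
    ← Unitary.star_eq_inv, Unitary.coe_star]

theorem diagMatrix_conj_mem {𝕜 : Type*} [RCLike 𝕜] {n : ℕ} {lam : Fin (n + 1) → ℝ}
    (t : Fin (n + 1) → unitary 𝕜) {A : Matrix (Fin (n + 1)) (Fin (n + 1)) 𝕜}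
    (hA : A ∈ isospectralArrow 𝕜 lam) :
    diagMatrix t * A * diagMatrix t⁻¹ ∈ isospectralArrow 𝕜 lam := by
  obtain ⟨h1, h2, h3⟩ := hA
  refine ⟨?_, ?_, ?_⟩
  · ext i j
    rw [Matrix.conjTranspose_apply, diagMatrix_conj_apply, diagMatrix_conj_apply, ← h1.apply i j]
    simp only [star_mul, star_star]
    ring
  · intro i j hij hi hj
    rw [diagMatrix_conj_apply, h2 i j hij hi hj]
    simp
  · let u : (Matrix (Fin (n + 1)) (Fin (n + 1)) 𝕜)ˣ :=
      ⟨diagMatrix t, diagMatrix t⁻¹,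
        by rw [← diagMatrix_mul, mul_inv_cancel, diagMatrix_one],
        by rw [← diagMatrix_mul, inv_mul_cancel, diagMatrix_one]⟩
    have h : spectrum 𝕜 ((u : Matrix (Fin (n + 1)) (Fin (n + 1)) 𝕜) * A *
        ((u⁻¹ : (Matrix (Fin (n + 1)) (Fin (n + 1)) 𝕜)ˣ) : Matrix _ _ 𝕜)) = spectrum 𝕜 A :=
      spectrum.units_conjugate
    exact h.trans h3

/-- The action of diagonal unitary matrices on isospectral arrow matrices by conjugation,
`A ↦ D A D⁻¹`. -/
instance isospectralArrow.instMulActionPi (𝕜 : Type*) [RCLike 𝕜] {n : ℕ}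
    (lam : Fin (n + 1) → ℝ) :
    MulAction (Fin (n + 1) → unitary 𝕜) (isospectralArrow 𝕜 lam) where
  smul t A := ⟨diagMatrix t * A.1 * diagMatrix t⁻¹, diagMatrix_conj_mem t A.2⟩
  one_smul A := by
    apply Subtype.ext
    change diagMatrix 1 * A.1 * diagMatrix 1⁻¹ = A.1
    rw [inv_one, diagMatrix_one, one_mul, mul_one]
  mul_smul s t A := by
    apply Subtype.ext
    change diagMatrix (s * t) * A.1 * diagMatrix (s * t)⁻¹ =
      diagMatrix s * (diagMatrix t * A.1 * diagMatrix t⁻¹) * diagMatrix s⁻¹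
    rw [mul_inv_rev, diagMatrix_mul, diagMatrix_mul]
    simp only [mul_assoc]

/-- Scalar matrices act trivially. -/
theorem diagonalSubgroup_le_ker (𝕜 : Type*) [RCLike 𝕜] {n : ℕ} (lam : Fin (n + 1) → ℝ) :
    diagonalSubgroup 𝕜 n ≤
      (MulAction.toPermHom (Fin (n + 1) → unitary 𝕜) (isospectralArrow 𝕜 lam)).ker := by
  rintro _ ⟨z, rfl⟩
  rw [MonoidHom.mem_ker]
  ext1 A
  apply Subtype.ext
  ext i j
  change (diagMatrix (Pi.constMonoidHom (Fin (n + 1)) (unitary 𝕜) z) * A.1 *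
    diagMatrix (Pi.constMonoidHom (Fin (n + 1)) (unitary 𝕜) z)⁻¹) i j = A.1 i j
  refine (diagMatrix_conj_apply _ _ _ _).trans ?_
  rw [mul_right_comm]
  simp only [Pi.constMonoidHom_apply, Function.const_apply]
  rw [Unitary.mul_star_self_of_mem z.2, one_mul]

/-- The induced action of the quotient torus on isospectral arrow matrices. -/
instance isospectralArrow.instMulActionReducedTorus (𝕜 : Type*) [RCLike 𝕜] {n : ℕ}
    (lam : Fin (n + 1) → ℝ) :
    MulAction (ReducedTorus 𝕜 n) (isospectralArrow 𝕜 lam) :=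
  MulAction.compHom (isospectralArrow 𝕜 lam)
    (QuotientGroup.lift (diagonalSubgroup 𝕜 n)
      (MulAction.toPermHom (Fin (n + 1) → unitary 𝕜) (isospectralArrow 𝕜 lam))
      (diagonalSubgroup_le_ker 𝕜 lam))

/-- On classes of diagonal matrices the action is `a_{ij} ↦ t_i t_j⁻¹ a_{ij}`. -/
theorem isospectralArrow.coe_mk_smul_apply {𝕜 : Type*} [RCLike 𝕜] {n : ℕ}
    {lam : Fin (n + 1) → ℝ} (t : Fin (n + 1) → unitary 𝕜) (A : isospectralArrow 𝕜 lam)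
    (i j : Fin (n + 1)) :
    (((t : ReducedTorus 𝕜 n) • A : isospectralArrow 𝕜 lam) :
      Matrix (Fin (n + 1)) (Fin (n + 1)) 𝕜) i j =
      (t i : 𝕜) * A.1 i j * ((t j)⁻¹ : unitary 𝕜) :=
  diagMatrix_conj_apply t A.1 i j

/-- The inclusion of the set of isospectral arrow matrices into the real vector space of all
`(n + 1) × (n + 1)` arrays with entries in `𝕜`. -/
def isospectralArrow.entries {𝕜 : Type*} [RCLike 𝕜] {n : ℕ} {lam : Fin (n + 1) → ℝ}
    (A : isospectralArrow 𝕜 lam) : Fin (n + 1) → Fin (n + 1) → 𝕜 :=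
  fun i j => A.1 i j

/-- An action of a topological group `G` on a smooth manifold `M` is locally standard, with
respect to the coordinatewise action of `(unitary 𝕜) ^ n` on `𝕜 ^ n` (the standard action of
`T ^ n` on `ℂ ^ n` for `𝕜 = ℂ`, that of `ℤ₂ ^ n = {±1} ^ n` on `ℝ ^ n` for `𝕜 = ℝ`): every point
has a `G`-invariant open neighbourhood and a diffeomorphism `φ` from it onto an
invariant open subset of `𝕜 ^ n` which is equivariant along some isomorphism
`ψ : G ≅ (unitary 𝕜) ^ n` of topological groups. -/
def IsLocallyStandard (𝕜 : Type*) [RCLike 𝕜] (n : ℕ) (G : Type*) [Group G] [TopologicalSpace G]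
    {E H : Type*} [NormedAddCommGroup E] [NormedSpace ℝ E] [TopologicalSpace H]
    (I : ModelWithCorners ℝ E H) (M : Type*) [TopologicalSpace M] [ChartedSpace H M]
    [MulAction G M] : Prop :=
  ∀ x : M, ∃ (φ : OpenPartialHomeomorph M (Fin n → 𝕜)) (ψ : G ≃ₜ* (Fin n → unitary 𝕜)),
    x ∈ φ.source ∧
    (∀ g : G, ∀ y ∈ φ.source, g • y ∈ φ.source) ∧
    (∀ s : Fin n → unitary 𝕜, ∀ v ∈ φ.target, (fun i => (s i : 𝕜) * v i) ∈ φ.target) ∧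
    ContMDiffOn I 𝓘(ℝ, Fin n → 𝕜) ∞ φ φ.source ∧
    ContMDiffOn 𝓘(ℝ, Fin n → 𝕜) I ∞ φ.symm φ.target ∧
    ∀ g : G, ∀ y ∈ φ.source, φ (g • y) = fun i => (ψ g i : 𝕜) * φ y i

/-! The torus changes only the phases of the entries `a_{0i}`; the diagonal `d` and the squared
moduli `r_i = |a_{0i}|²` are invariant. The determinant of an arrow matrix sees its off-diagonal
entries only through the products `a_{0i} a_{i0}`, so the spectral condition is a system of `n + 1`
real polynomial equations `charValues lam (d, r) = 0` in `2n + 1` real unknowns, the same for both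
fields.

The core is transversality (`eq_zero_of_sum_fderiv_charValues`): at a solution, the differential of
`charValues` stays surjective on the directions that fix the vanishing `r_i`. It follows from
Jacobi's formula and the simplicity of the spectrum. Hence `charValues` and the vanishing `r_i` are
part of a local coordinate system, whose other coordinates can be made positive
(`exists_coordinates_charValues`).

On the solution set this leaves `n` coordinates `c_i`, with `c_i = r_i` wherever `r_i` vanishes at
the centre. Keeping the phase of `a_{0i}` and changing its squared modulus to `c_i` gives an
equivariant chart into `𝕜 ^ n` (`exists_equivariant_chart`). No square root is taken where an entry
may vanish, so the chart and its inverse are smooth. Such charts extend to open sets of the ambient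
space, which yields the embedded submanifold structure (`exists_isSmoothEmbedding_of_charts`). -/

/-! ### Jacobi's formula and matrices with simple spectrum. -/

/-- Jacobi's formula: the Leibniz expansion is differentiated column by column, and Cramer's rule
identifies the determinant with column `i` replaced as a diagonal entry of the product. -/
theorem Matrix.hasDerivAt_det {ι : Type*} [Fintype ι] [DecidableEq ι] {M : ℝ → Matrix ι ι ℝ}
    {M' : Matrix ι ι ℝ} {x : ℝ} (h : ∀ i j, HasDerivAt (fun t => M t i j) (M' i j) x) :
    HasDerivAt (fun t => (M t).det) ((M x).adjugate * M').trace x := by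
  have h1 : HasDerivAt (fun t => (M t).det) (∑ σ : Equiv.Perm ι, ((Equiv.Perm.sign σ : ℤ) : ℝ) *
      ∑ i, (∏ j ∈ Finset.univ.erase i, M x (σ j) j) • M' (σ i) i) x := by
    simp only [Matrix.det_apply']
    exact HasDerivAt.fun_sum fun σ _ =>
      (HasDerivAt.fun_finsetProd fun i _ => h (σ i) i).const_mul _
  convert! h1 using 1
  have h2 : ∀ i, ((M x).updateCol i fun k => M' k i).det =
      ∑ σ : Equiv.Perm ι, ((Equiv.Perm.sign σ : ℤ) : ℝ) *
        ((∏ j ∈ Finset.univ.erase i, M x (σ j) j) • M' (σ i) i) := by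
    intro i
    rw [Matrix.det_apply']
    refine Finset.sum_congr rfl fun σ _ => ?_
    rw [← Finset.prod_erase_mul _ _ (Finset.mem_univ i), Matrix.updateCol_self, smul_eq_mul]
    congr 2
    refine Finset.prod_congr rfl fun j hj => ?_
    rw [Matrix.updateCol_ne (Finset.ne_of_mem_erase hj)]
  simp only [Finset.mul_sum]
  rw [Finset.sum_comm, Matrix.trace]
  refine Finset.sum_congr rfl fun i _ => ?_
  rw [← h2, ← Matrix.cramer_apply, Matrix.cramer_eq_adjugate_mulVec]
  rfl

/-- If the distinct scalars `μ i` are eigenvalues, then they are all the roots of the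
characteristic polynomial. -/
theorem Matrix.charpoly_eq_prod_of_det_eq_zero {K : Type*} [Field K] {n : ℕ}
    {A : Matrix (Fin n) (Fin n) K} {μ : Fin n → K} (hμ : Function.Injective μ)
    (h : ∀ k, (Matrix.scalar (Fin n) (μ k) - A).det = 0) :
    A.charpoly = ∏ k, (Polynomial.X - Polynomial.C (μ k)) := by
  refine Polynomial.eq_of_monic_of_dvd_of_natDegree_le
    (Polynomial.monic_prod_of_monic _ _ fun k _ => Polynomial.monic_X_sub_C _)
    A.charpoly_monic ?_ ?_
  · refine Finset.prod_dvd_of_coprime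
      (fun i _ j _ hij => Polynomial.pairwise_coprime_X_sub_C hμ hij) fun k _ => ?_
    rw [Polynomial.dvd_iff_isRoot, Polynomial.IsRoot, Matrix.eval_charpoly, h]
  · rw [Matrix.charpoly_natDegree_eq_dim, Polynomial.natDegree_prod_of_monic _ _
      fun k _ => Polynomial.monic_X_sub_C _]
    simp

/-- Turns the spectral condition into finitely many polynomial equations: there are as many distinct
`μ k` as the size of the matrix, so no room is left for another eigenvalue. -/
theorem Matrix.spectrum_eq_range_iff {K : Type*} [Field K] {n : ℕ}
    {A : Matrix (Fin n) (Fin n) K} {μ : Fin n → K} (hμ : Function.Injective μ) :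
    spectrum K A = Set.range μ ↔ ∀ k, (Matrix.scalar (Fin n) (μ k) - A).det = 0 := by
  constructor
  · intro h k
    have : μ k ∈ spectrum K A := h ▸ Set.mem_range_self k
    rwa [Matrix.mem_spectrum_iff_isRoot_charpoly, Polynomial.IsRoot,
      Matrix.eval_charpoly] at this
  · intro h
    ext x
    rw [Matrix.mem_spectrum_iff_isRoot_charpoly, Matrix.charpoly_eq_prod_of_det_eq_zero hμ h,
      Polynomial.IsRoot, Polynomial.eval_prod, Finset.prod_eq_zero_iff]
    simp [sub_eq_zero, eq_comm]

/-- By Jacobi's formula this trace is the derivative of the characteristic polynomial at `μ k`,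
which is a simple root. -/
theorem Matrix.trace_adjugate_ne_zero {n : ℕ}
    {A : Matrix (Fin n) (Fin n) ℝ} {μ : Fin n → ℝ} (hμ : Function.Injective μ)
    (h : ∀ k, (Matrix.scalar (Fin n) (μ k) - A).det = 0) (k : Fin n) :
    (Matrix.scalar (Fin n) (μ k) - A).adjugate.trace ≠ 0 := by
  have h1 : HasDerivAt (fun t => (Matrix.scalar (Fin n) t - A).det)
      ((Matrix.scalar (Fin n) (μ k) - A).adjugate * 1).trace (μ k) := by
    refine Matrix.hasDerivAt_det fun i j => ?_
    simp only [Matrix.scalar_apply, Matrix.sub_apply, Matrix.diagonal_apply, Matrix.one_apply]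
    split_ifs
    · exact (hasDerivAt_id _).sub_const _
    · exact hasDerivAt_const _ _
  have h2 := (Polynomial.hasDerivAt A.charpoly (μ k))
  simp only [Matrix.eval_charpoly] at h2
  rw [Matrix.mul_one] at h1
  rw [h1.unique h2, Matrix.charpoly_eq_prod_of_det_eq_zero hμ h, Polynomial.derivative_prod_finset,
    Polynomial.eval_finsetSum, Finset.sum_eq_single k]
  · simp only [Polynomial.eval_prod, Polynomial.derivative_sub,
      Polynomial.derivative_X, Polynomial.derivative_C, sub_zero, mul_one,
      Polynomial.eval_sub, Polynomial.eval_X, Polynomial.eval_C]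
    refine Finset.prod_ne_zero_iff.2 fun j hj => sub_ne_zero.2 fun e => ?_
    exact Finset.ne_of_mem_erase hj (hμ e).symm
  · intro j _ hj
    rw [Polynomial.eval_mul, Polynomial.eval_prod,
      Finset.prod_eq_zero (Finset.mem_erase.2 ⟨hj.symm, Finset.mem_univ k⟩) (by simp), zero_mul]
  · simp

/-! ### Arrow matrices and their determinants. -/

/-- The arrow matrix with diagonal `d`, first row `u` and first column `v`
(outside the corner). -/
def arrowMatrix {R : Type*} [Zero R] {n : ℕ} (d : Fin (n + 1) → R) (u v : Fin n → R) :
    Matrix (Fin (n + 1)) (Fin (n + 1)) R :=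
  Fin.cons (Fin.cons (d 0) u) fun i => Fin.cons (v i) (Pi.single i (d i.succ))

section arrowMatrix

variable {R : Type*} [Zero R] {n : ℕ} (d : Fin (n + 1) → R) (u v : Fin n → R)

@[simp] theorem arrowMatrix_zero_zero : arrowMatrix d u v 0 0 = d 0 := rfl
@[simp] theorem arrowMatrix_zero_succ (j : Fin n) : arrowMatrix d u v 0 j.succ = u j := rfl
@[simp] theorem arrowMatrix_succ_zero (i : Fin n) : arrowMatrix d u v i.succ 0 = v i := rfl
@[simp] theorem arrowMatrix_succ_succ (i j : Fin n) :
    arrowMatrix d u v i.succ j.succ = if i = j then d i.succ else 0 := by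
  simp [arrowMatrix, Pi.single_apply, eq_comm]

theorem arrowMatrix_self (i : Fin (n + 1)) : arrowMatrix d u v i i = d i := by
  cases i using Fin.cases <;> simp

theorem arrowMatrix_eq_zero {i j : Fin (n + 1)} (hij : i ≠ j) (hi : i ≠ 0) (hj : j ≠ 0) :
    arrowMatrix d u v i j = 0 := by
  obtain ⟨i, rfl⟩ := Fin.exists_succ_eq.2 hi
  obtain ⟨j, rfl⟩ := Fin.exists_succ_eq.2 hj
  simp only [arrowMatrix_succ_succ, ite_eq_right_iff]
  rintro rfl
  exact absurd rfl hij

theorem eq_arrowMatrix {A : Matrix (Fin (n + 1)) (Fin (n + 1)) R}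
    (h : ∀ i j, i ≠ j → i ≠ 0 → j ≠ 0 → A i j = 0) :
    A = arrowMatrix (fun i => A i i) (fun j => A 0 j.succ) (fun i => A i.succ 0) := by
  ext i j
  cases i using Fin.cases <;> cases j using Fin.cases
  · simp
  · simp
  · simp
  · rename_i i j
    rw [arrowMatrix_succ_succ]
    split_ifs with e
    · rw [e]
    · exact h _ _ (by simpa using e) (Fin.succ_ne_zero _) (Fin.succ_ne_zero _)

end arrowMatrix

theorem scalar_sub_arrowMatrix {R : Type*} [CommRing R] {n : ℕ} (r : R) (d : Fin (n + 1) → R)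
    (u v : Fin n → R) : Matrix.scalar (Fin (n + 1)) r - arrowMatrix d u v =
      arrowMatrix (fun i => r - d i) (-u) (-v) := by
  ext i j
  cases i using Fin.cases <;> cases j using Fin.cases <;>
    simp [Matrix.diagonal_apply, Fin.succ_ne_zero, (Fin.succ_ne_zero _).symm]
  split_ifs <;> simp

/-- The determinant of an arrow matrix depends on the off-diagonal entries only through the
products of opposite ones. -/
theorem det_arrowMatrix_mul {𝕜 : Type*} [RCLike 𝕜] {n : ℕ} (d : Fin (n + 1) → 𝕜)
    (u v s : Fin n → 𝕜) :
    (arrowMatrix d (u * s) v).det = (arrowMatrix d u (s * v)).det := by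
  -- Both sides are continuous in `s`, so `s` may be assumed to have no zero coordinate; then
  -- `diag(1, s)` conjugates one matrix into the other.
  have hdense : Dense {s : Fin n → 𝕜 | ∀ i, s i ≠ 0} := by
    have := dense_pi (s := fun _ : Fin n => ({0}ᶜ : Set 𝕜)) Set.univ
      fun i _ => dense_compl_singleton 0
    convert this using 1
    ext; simp
  have hcont : ∀ {f g : (Fin n → 𝕜) → Fin n → 𝕜}, Continuous f → Continuous g →
      Continuous fun s => (arrowMatrix d (f s) (g s)).det := by
    intro f g hf hg
    refine Continuous.matrix_det (continuous_matrix fun i j => ?_)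
    cases i using Fin.cases <;> cases j using Fin.cases <;> simp only [arrowMatrix_zero_zero,
      arrowMatrix_zero_succ, arrowMatrix_succ_zero, arrowMatrix_succ_succ] <;> fun_prop
  refine congrFun (Continuous.ext_on hdense
    (f := fun s => (arrowMatrix d (u * s) v).det) (g := fun s => (arrowMatrix d u (s * v)).det)
    (hcont (by fun_prop) (by fun_prop)) (hcont (by fun_prop) (by fun_prop)) ?_) s
  intro s hs
  have h1 : Matrix.diagonal (Fin.cons 1 s) * arrowMatrix d (u * s) v =
      arrowMatrix d u (s * v) * Matrix.diagonal (Fin.cons 1 s) := by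
    ext i j
    rw [Matrix.diagonal_mul, Matrix.mul_diagonal]
    cases i using Fin.cases <;> cases j using Fin.cases <;> simp
    split_ifs with e
    · rw [e, mul_comm]
    · rfl
  have h2 := congrArg Matrix.det h1
  rw [Matrix.det_mul, Matrix.det_mul, mul_comm] at h2
  refine mul_right_cancel₀ ?_ h2
  rw [Matrix.det_diagonal, Fin.prod_univ_succ]
  simpa [Finset.prod_ne_zero_iff] using hs

/-! ### Inverse function theorem and embedded submanifolds. -/

/-- The inverse function theorem on an open set, for smooth maps. -/
theorem exists_openPartialHomeomorph_of_contDiffOn {E F : Type*} [NormedAddCommGroup E]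
    [NormedSpace ℝ E] [CompleteSpace E] [NormedAddCommGroup F] [NormedSpace ℝ F]
    {f : E → F} {U : Set E} (hU : IsOpen U) (hf : ContDiffOn ℝ ∞ f U) {p : E} (hp : p ∈ U)
    {f' : E ≃L[ℝ] F} (hf' : HasFDerivAt f (f' : E →L[ℝ] F) p) :
    ∃ e : OpenPartialHomeomorph E F, p ∈ e.source ∧ e.source ⊆ U ∧ (e : E → F) = f ∧
      ContDiffOn ℝ ∞ e e.source ∧ ContDiffOn ℝ ∞ e.symm e.target := by
  have hfat : ∀ x ∈ U, ContDiffAt ℝ ∞ f x := fun x hx => hf.contDiffAt (hU.mem_nhds hx)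
  have hD : ContinuousOn (fderiv ℝ f) U := hf.continuousOn_fderiv_of_isOpen hU (by simp)
  -- Smoothness of the inverse at a point needs an invertible derivative there, so the source is
  -- shrunk to the open set where this holds.
  set V : Set E := U ∩ fderiv ℝ f ⁻¹' Set.range ((↑) : (E ≃L[ℝ] F) → E →L[ℝ] F) with hV
  have hVo : IsOpen V := hD.isOpen_inter_preimage hU ContinuousLinearEquiv.isOpen
  have hpV : p ∈ V := ⟨hp, f', hf'.fderiv.symm⟩
  set e₀ := (hfat p hp).toOpenPartialHomeomorph f hf' (by simp) with he₀
  have hsrc : (e₀.restrOpen V hVo).source = e₀.source ∩ V := rfl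
  refine ⟨e₀.restrOpen V hVo, ?_, ?_, rfl, ?_, ?_⟩
  · exact ⟨(hfat p hp).mem_toOpenPartialHomeomorph_source hf' (by simp), hpV⟩
  · exact fun x hx => hx.2.1
  · exact hf.mono fun x hx => hx.2.1
  · intro y hy
    have hy' := (e₀.restrOpen V hVo).map_target hy
    obtain ⟨g, hg⟩ := hy'.2.2
    refine ((e₀.restrOpen V hVo).contDiffAt_symm hy (f₀' := g) ?_
      (hfat _ hy'.2.1)).contDiffWithinAt
    rw [hg]
    exact ((hfat _ hy'.2.1).differentiableAt (by simp)).hasFDerivAt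

/-- An injective linear map between finite-dimensional spaces extends to an isomorphism from the
product with a space of complementary dimension. -/
theorem LinearMap.exists_continuousLinearEquiv_prod {V W E : Type*} [NormedAddCommGroup V]
    [NormedSpace ℝ V] [FiniteDimensional ℝ V] [NormedAddCommGroup W] [NormedSpace ℝ W]
    [FiniteDimensional ℝ W] [NormedAddCommGroup E] [NormedSpace ℝ E] [FiniteDimensional ℝ E]
    (f : V →ₗ[ℝ] E) (hf : Function.Injective f)
    (hdim : Module.finrank ℝ V + Module.finrank ℝ W = Module.finrank ℝ E) :
    ∃ S : (V × W) ≃L[ℝ] E, ∀ v, S (v, 0) = f v := by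
  obtain ⟨C, hC⟩ := Submodule.exists_isCompl (LinearMap.range f)
  have h1 := Submodule.finrank_add_eq_of_isCompl hC
  rw [LinearMap.finrank_range_of_inj hf] at h1
  let e : W ≃ₗ[ℝ] C := LinearEquiv.ofFinrankEq _ _ (by omega)
  refine ⟨(((LinearEquiv.ofInjective f hf).prodCongr e).trans
    (Submodule.prodEquivOfIsCompl _ _ hC)).toContinuousLinearEquiv, fun v => ?_⟩
  simp [Submodule.coe_prodEquivOfIsCompl']

open Manifold in
/-- A subset of a finite-dimensional space, or more generally a space `M` embedded into it, all
points of which have smooth parametrizations with smooth inverses, is an embedded submanifold, with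
these parametrizations as charts. -/
theorem exists_isSmoothEmbedding_of_charts {E V : Type} [NormedAddCommGroup E] [NormedSpace ℝ E]
    [FiniteDimensional ℝ E] [NormedAddCommGroup V] [NormedSpace ℝ V] [FiniteDimensional ℝ V]
    {M : Type*} [TopologicalSpace M] {ι : M → E} (hι : Topology.IsEmbedding ι)
    {m : ℕ} (hm : Module.finrank ℝ V = m)
    (φ : M → OpenPartialHomeomorph M V) (hφ : ∀ x, x ∈ (φ x).source)
    (hsymm : ∀ x, ContDiffOn ℝ ∞ (ι ∘ (φ x).symm) (φ x).target)
    (Φ : M → E → V) (U : M → Set E) (hU : ∀ x, IsOpen (U x))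
    (hΦ : ∀ x, ContDiffOn ℝ ∞ (Φ x) (U x))
    (hφU : ∀ x, Set.MapsTo ι (φ x).source (U x))
    (hφΦ : ∀ x, Set.EqOn (φ x) (Φ x ∘ ι) (φ x).source) :
    ∃ _ : ChartedSpace (EuclideanSpace ℝ (Fin m)) M,
      IsManifold (𝓡 m) ∞ M ∧ IsSmoothEmbedding (𝓡 m) 𝓘(ℝ, E) ∞ ι ∧
      ∀ x, ContMDiffOn (𝓡 m) 𝓘(ℝ, V) ∞ (φ x) (φ x).source ∧
        ContMDiffOn 𝓘(ℝ, V) (𝓡 m) ∞ (φ x).symm (φ x).target := by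
  let T : V ≃L[ℝ] EuclideanSpace ℝ (Fin m) := ContinuousLinearEquiv.ofFinrankEq (by simp [hm])
  let c : M → OpenPartialHomeomorph M (EuclideanSpace ℝ (Fin m)) :=
    fun x => (φ x).transHomeomorph T.toHomeomorph
  let _ : ChartedSpace (EuclideanSpace ℝ (Fin m)) M :=
    { atlas := Set.range c
      chartAt := c
      mem_chart_source := hφ
      chart_mem_atlas := Set.mem_range_self }
  have hman : IsManifold (𝓡 m) ∞ M := by
    refine isManifold_of_contDiffOn _ _ _ ?_
    rintro _ _ ⟨x, rfl⟩ ⟨y, rfl⟩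
    -- Transition maps are smooth because `φ y` is the restriction of the smooth ambient map `Φ y`.
    have : ContDiffOn ℝ ∞ (T ∘ Φ y ∘ (ι ∘ (φ x).symm) ∘ T.symm)
        (T.symm ⁻¹' ((φ x).target ∩ (φ x).symm ⁻¹' (φ y).source)) := by
      refine T.contDiff.comp_contDiffOn ((hΦ y).comp
        (((hsymm x).mono Set.inter_subset_left).comp T.symm.contDiff.contDiffOn
          (Set.mapsTo_preimage _ _)) ?_)
      intro z hz
      exact hφU y hz.2
    simp only [modelWithCornersSelf_coe, modelWithCornersSelf_coe_symm, Set.preimage_id,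
      Set.range_id, Set.inter_univ, Function.comp_id, Function.id_comp]
    refine (this.congr ?_).mono ?_
    · intro z hz
      exact congrArg T (hφΦ y hz.2)
    · intro z hz
      simpa [c] using hz
  have hφc : ∀ x, ContMDiffOn (𝓡 m) 𝓘(ℝ, V) ∞ (φ x) (φ x).source := by
    intro x
    have h1 : ContMDiffOn (𝓡 m) (𝓡 m) ∞ (c x) (c x).source :=
      contMDiffOn_of_mem_maximalAtlas (IsManifold.subset_maximalAtlas (Set.mem_range_self x))
    have h2 := T.symm.contDiff (n := ∞) |>.contMDiff.comp_contMDiffOn h1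
    exact h2.congr fun z _ => (T.symm_apply_apply _).symm
  have hφs : ∀ x, ContMDiffOn 𝓘(ℝ, V) (𝓡 m) ∞ (φ x).symm (φ x).target := by
    intro x
    have h1 : ContMDiffOn (𝓡 m) (𝓡 m) ∞ (c x).symm (c x).target :=
      contMDiffOn_symm_of_mem_maximalAtlas (IsManifold.subset_maximalAtlas (Set.mem_range_self x))
    have h2 := h1.comp (T.contDiff (n := ∞)).contMDiff.contMDiffOn (s := (φ x).target)
      (fun z hz => by simpa [c] using hz)
    exact h2.congr fun z _ => congrArg (φ x).symm (T.symm_apply_apply _).symm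
  refine ⟨inferInstance, hman, ⟨?_, hι⟩, fun x => ⟨hφc x, hφs x⟩⟩
  refine IsImmersionOfComplement.isImmersion
    (F := EuclideanSpace ℝ (Fin (Module.finrank ℝ E - m))) fun x => ?_
  set u₀ : EuclideanSpace ℝ (Fin m) := c x x with hu₀
  have hu₀t : u₀ ∈ (c x).target := (c x).map_source (hφ x)
  set g : EuclideanSpace ℝ (Fin m) → E := ι ∘ (c x).symm with hg
  have hgs : ContDiffOn ℝ ∞ g (c x).target :=
    (hsymm x).comp T.symm.contDiff.contDiffOn (fun z hz => by simpa [c] using hz)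
  have hgd : HasFDerivAt g (fderiv ℝ g u₀) u₀ :=
    ((hgs.contDiffAt ((c x).open_target.mem_nhds hu₀t)).differentiableAt (by simp)).hasFDerivAt
  have hgu₀ : g u₀ = ι x := congrArg ι ((c x).left_inv (hφ x))
  -- `T ∘ Φ x` is a smooth left inverse of `g` near `u₀`.
  have hinj : Function.Injective (fderiv ℝ g u₀) := by
    have h1 : HasFDerivAt (T ∘ Φ x) (fderiv ℝ (T ∘ Φ x) (g u₀)) (g u₀) := by
      refine ((T.contDiff.comp_contDiffOn (hΦ x)).contDiffAt
        ((hU x).mem_nhds ?_)).differentiableAt (by simp) |>.hasFDerivAt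
      rw [hgu₀]
      exact hφU x (hφ x)
    have h2 := h1.comp u₀ hgd
    have h3 : HasFDerivAt ((T ∘ Φ x) ∘ g)
        (ContinuousLinearMap.id ℝ (EuclideanSpace ℝ (Fin m))) u₀ := by
      refine (hasFDerivAt_id u₀).congr_of_eventuallyEq ?_
      filter_upwards [(c x).open_target.mem_nhds hu₀t] with u hu
      have h4 : T (φ x ((c x).symm u)) = u := (c x).right_inv hu
      rw [hφΦ x ((c x).map_target hu)] at h4
      exact h4
    intro a b hab
    have h5 := h2.unique h3
    have h6 := congrArg (fun L => L a) h5
    have h7 := congrArg (fun L => L b) h5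
    simp only [ContinuousLinearMap.comp_apply, ContinuousLinearMap.id_apply] at h6 h7
    rw [← h6, ← h7, hab]
  obtain ⟨S, hS⟩ := LinearMap.exists_continuousLinearEquiv_prod
    (W := EuclideanSpace ℝ (Fin (Module.finrank ℝ E - m)))
    (fderiv ℝ g u₀).toLinearMap hinj (by
      have := LinearMap.finrank_le_finrank_of_injective (f := (fderiv ℝ g u₀).toLinearMap) hinj
      simp only [finrank_euclideanSpace, Fintype.card_fin] at this ⊢
      omega)
  let pr₁ : E →L[ℝ] EuclideanSpace ℝ (Fin m) :=
    (ContinuousLinearMap.fst ℝ _ _).comp S.symm.toContinuousLinearMap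
  let q : E →L[ℝ] E := S.toContinuousLinearMap.comp ((ContinuousLinearMap.inr ℝ _ _).comp
    ((ContinuousLinearMap.snd ℝ _ _).comp S.symm.toContinuousLinearMap))
  -- `K` sends `S (u, w)` to `g u + S (0, w)`. Its derivative at `S (u₀, 0)` is the identity, so its
  -- local inverse is an ambient chart in which `g` becomes `u ↦ S (u, 0)`.
  let K : E → E := fun e => g (pr₁ e) + q e
  have hpr : ∀ u, pr₁ (S (u, 0)) = u := fun u => by simp [pr₁]
  have hK : ∀ u, K (S (u, 0)) = g u := fun u => by simp [K, hpr, q]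
  obtain ⟨e, he1, he2, he3, he4, he5⟩ := exists_openPartialHomeomorph_of_contDiffOn
    (f := K) (U := pr₁ ⁻¹' (c x).target) ((c x).open_target.preimage pr₁.continuous)
    ((hgs.comp pr₁.contDiff.contDiffOn (Set.mapsTo_preimage _ _)).add q.contDiff.contDiffOn)
    (p := S (u₀, 0)) (by simpa [hpr] using hu₀t) (f' := ContinuousLinearEquiv.refl ℝ E) (by
      have h1 : HasFDerivAt g (fderiv ℝ g u₀) (pr₁ (S (u₀, 0))) := by rwa [hpr]
      refine ((h1.comp _ pr₁.hasFDerivAt).add q.hasFDerivAt).congr_fderiv ?_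
      ext a
      obtain ⟨⟨v, w⟩, rfl⟩ := S.surjective a
      have h2 : (fderiv ℝ g u₀) v = S (v, 0) := (hS v).symm
      simp only [pr₁, q, add_apply, ContinuousLinearMap.comp_apply,
        ContinuousLinearEquiv.coe_coe, ContinuousLinearEquiv.symm_apply_apply,
        ContinuousLinearMap.coe_fst', ContinuousLinearMap.coe_snd', ContinuousLinearMap.inr_apply,
        h2, ← map_add]
      simp)
  set W : Set M := (c x).source ∩ c x ⁻¹' {u | S (u, 0) ∈ e.source} with hW
  have hWo : IsOpen W := (c x).isOpen_inter_preimage (e.open_source.preimage (by fun_prop))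
  refine IsImmersionAtOfComplement.mk_of_continuousAt hι.continuous.continuousAt S
    ((c x).restr W) e.symm ?_ ?_ ?_ ?_ ?_
  · rw [(c x).restr_source' W hWo]
    exact ⟨hφ x, hφ x, he1⟩
  · have := e.map_source he1
    rwa [he3, hK, hgu₀] at this
  · exact restr_mem_maximalAtlas _ (IsManifold.subset_maximalAtlas (Set.mem_range_self x)) hWo
  · refine StructureGroupoid.mem_maximalAtlas_of_mem_groupoid _ ?_
    rw [contDiffGroupoid, mem_groupoid_of_pregroupoid]
    constructor
    · simpa [contDiffPregroupoid] using he5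
    · simpa [contDiffPregroupoid] using he4
  · intro u hu
    have h1 : S (u, 0) ∈ e.source := by
      have h3 : u ∈ ((c x).restr W).target := by simpa using hu
      have h4 : (c x).symm u ∈ ((c x).restr W).source := ((c x).restr W).map_target h3
      rw [(c x).restr_source' W hWo] at h4
      have h5 := h4.2.2
      rwa [Set.mem_preimage, (c x).right_inv h3.1] at h5
    have h2 : e.symm (g u) = S (u, 0) := by
      rw [← hK, ← he3, e.left_inv h1]
    exact h2

/-! ### The spectral equations and their transversality to the coordinate faces. -/

/-- The values at the points `lam k` of the characteristic polynomial of the arrow matrices with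
diagonal `y.1` whose products of opposite off-diagonal entries are `y.2`. -/
def charValues {n : ℕ} (lam : Fin (n + 1) → ℝ) (y : (Fin (n + 1) → ℝ) × (Fin n → ℝ)) :
    Fin (n + 1) → ℝ :=
  fun k => (Matrix.scalar (Fin (n + 1)) (lam k) - arrowMatrix y.1 y.2 1).det

theorem contDiff_charValues {n : ℕ} (lam : Fin (n + 1) → ℝ) : ContDiff ℝ ∞ (charValues lam) := by
  refine contDiff_pi.2 fun k => ?_
  simp only [charValues, scalar_sub_arrowMatrix, Matrix.det_apply']
  refine ContDiff.sum fun σ _ => contDiff_const.mul (contDiff_prod fun i _ => ?_)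
  generalize σ i = j
  cases i using Fin.cases <;> cases j using Fin.cases <;>
    simp only [arrowMatrix_zero_zero, arrowMatrix_zero_succ, arrowMatrix_succ_zero,
      arrowMatrix_succ_succ, Pi.neg_apply, Pi.one_apply]
  all_goals first | fun_prop | (split_ifs <;> fun_prop)

/-- Jacobi's formula. The first column of the varying matrix is constantly `1`, hence the `0` in the
direction matrix. -/
theorem fderiv_charValues_apply {n : ℕ} (lam : Fin (n + 1) → ℝ)
    (y v : (Fin (n + 1) → ℝ) × (Fin n → ℝ)) (k : Fin (n + 1)) :
    fderiv ℝ (charValues lam) y v k =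
      -((Matrix.scalar (Fin (n + 1)) (lam k) - arrowMatrix y.1 y.2 1).adjugate *
        arrowMatrix v.1 v.2 0).trace := by
  have h1 : HasDerivAt (fun t : ℝ => charValues lam (y + t • v) k)
      (fderiv ℝ (charValues lam) y v k) 0 := by
    have h2 : HasFDerivAt (charValues lam) (fderiv ℝ (charValues lam) y) (y + (0 : ℝ) • v) := by
      rw [zero_smul, add_zero]
      exact ((contDiff_charValues lam).differentiable (by simp) y).hasFDerivAt
    have h3 : HasDerivAt (fun t : ℝ => y + t • v) v 0 := by
      simpa using ((hasDerivAt_id (0 : ℝ)).smul_const v).const_add y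
    exact hasDerivAt_pi.1 (h2.comp_hasDerivAt 0 h3) k
  have h4 : HasDerivAt (fun t : ℝ => charValues lam (y + t • v) k)
      ((Matrix.scalar (Fin (n + 1)) (lam k) -
        arrowMatrix (y + (0 : ℝ) • v).1 (y + (0 : ℝ) • v).2 1).adjugate *
        -arrowMatrix v.1 v.2 0).trace 0 := by
    refine Matrix.hasDerivAt_det fun i j => ?_
    simp only [scalar_sub_arrowMatrix]
    have h5 : ∀ a b c : ℝ, HasDerivAt (fun t : ℝ => a - (b + t * c)) (-c) 0 := fun a b c => by
      simpa using (((hasDerivAt_id (0 : ℝ)).mul_const c).const_add b).const_sub a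
    have h6 : ∀ b c : ℝ, HasDerivAt (fun t : ℝ => -(b + t * c)) (-c) 0 := fun b c => by
      have h7 := (((hasDerivAt_id (0 : ℝ)).mul_const c).const_add b).fun_neg
      rwa [one_mul] at h7
    cases i using Fin.cases <;> cases j using Fin.cases <;> simp
    · exact h5 _ _ _
    · rename_i i
      simpa using h6 (y.2 i) (v.2 i)
    · exact hasDerivAt_const _ _
    · split_ifs
      · exact h5 _ _ _
      · simpa using hasDerivAt_const _ _
  rw [h1.unique h4, zero_smul, add_zero, Matrix.mul_neg, Matrix.trace_neg]

theorem trace_mul_arrowMatrix {n : ℕ} (B : Matrix (Fin (n + 1)) (Fin (n + 1)) ℝ)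
    (d : Fin (n + 1) → ℝ) (u : Fin n → ℝ) :
    (B * arrowMatrix d u 0).trace = ∑ i, B i i * d i + ∑ i : Fin n, B i.succ 0 * u i := by
  rw [Matrix.trace, Fin.sum_univ_succ, Fin.sum_univ_succ (fun i => B i i * d i), add_assoc,
    ← Finset.sum_add_distrib]
  congr 1
  · simp [Matrix.mul_apply, Fin.sum_univ_succ]
  · refine Finset.sum_congr rfl fun i _ => ?_
    simp [Matrix.mul_apply, Fin.sum_univ_succ]
    ring

/-- Row vectors that are left eigenvectors for distinct eigenvalues, or zero, vanish if their sum
vanishes. -/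
theorem Matrix.eq_zero_of_sum_vecMul_eq_smul {K ι κ : Type*} [Field K] [Fintype ι] [Fintype κ]
    [DecidableEq ι]
    {A : Matrix ι ι K} {μ : κ → K} (hμ : Function.Injective μ) {r : κ → ι → K}
    (h : ∀ k, r k ᵥ* A = μ k • r k) (hsum : ∑ k, r k = 0) (k : κ) : r k = 0 := by
  have h1 := Module.End.eigenspaces_iSupIndep (Matrix.toLin' Aᵀ)
  have h2 := (h1.comp hμ)
  rw [iSupIndep_iff_finsetSum_eq_zero_imp_eq_zero] at h2
  refine h2 Finset.univ r (fun i _ => ?_) hsum k (Finset.mem_univ k)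
  rw [Function.comp_apply, Module.End.mem_eigenspace_iff, Matrix.toLin'_apply,
    Matrix.mulVec_transpose, h]

/-- This is surjectivity in dual form: `w` is a covector killing the image of the directions tangent
to the coordinate face of `y`. The adjugates `B k` commute with `A` and consist of eigenvectors for
`lam k`; the proof studies `∑ k, w k • B k`. -/
theorem eq_zero_of_sum_fderiv_charValues {n : ℕ} {lam : Fin (n + 1) → ℝ}
    (hlam : Function.Injective lam) {y : (Fin (n + 1) → ℝ) × (Fin n → ℝ)}
    (hy : charValues lam y = 0) {w : Fin (n + 1) → ℝ}
    (hw : ∀ v : (Fin (n + 1) → ℝ) × (Fin n → ℝ), (∀ i, y.2 i = 0 → v.2 i = 0) →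
      ∑ k, w k * fderiv ℝ (charValues lam) y v k = 0) : w = 0 := by
  set A := arrowMatrix y.1 y.2 1 with hA
  set B : Fin (n + 1) → Matrix (Fin (n + 1)) (Fin (n + 1)) ℝ :=
    fun k => (Matrix.scalar (Fin (n + 1)) (lam k) - A).adjugate with hB
  have hdet : ∀ k, (Matrix.scalar (Fin (n + 1)) (lam k) - A).det = 0 := congrFun hy
  have hAB : ∀ k, A * B k = lam k • B k := by
    intro k
    have := Matrix.mul_adjugate (Matrix.scalar (Fin (n + 1)) (lam k) - A)
    rw [hdet, zero_smul, sub_mul, sub_eq_zero] at this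
    rw [← this, Matrix.scalar_apply, ← Matrix.smul_one_eq_diagonal, smul_mul_assoc, one_mul,
      Matrix.smul_one_eq_diagonal, ← Matrix.scalar_apply]
  have hBA : ∀ k, B k * A = lam k • B k := by
    intro k
    have := Matrix.adjugate_mul (Matrix.scalar (Fin (n + 1)) (lam k) - A)
    rw [hdet, zero_smul, mul_sub, sub_eq_zero] at this
    rw [← this, Matrix.scalar_apply, ← Matrix.smul_one_eq_diagonal, mul_smul_comm, mul_one,
      Matrix.smul_one_eq_diagonal, ← Matrix.scalar_apply]
  have htr : ∀ k, (B k).trace ≠ 0 := Matrix.trace_adjugate_ne_zero hlam hdet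
  have hw' : ∀ v : (Fin (n + 1) → ℝ) × (Fin n → ℝ), (∀ i, y.2 i = 0 → v.2 i = 0) →
      ∑ i, (∑ k, w k * B k i i) * v.1 i + ∑ i : Fin n, (∑ k, w k * B k i.succ 0) * v.2 i = 0 := by
    intro v hv
    have := hw v hv
    simp only [fderiv_charValues_apply, trace_mul_arrowMatrix] at this
    rw [← neg_eq_zero, ← this]
    simp only [Finset.sum_mul, mul_neg, mul_add, Finset.sum_add_distrib, Finset.mul_sum,
      Finset.sum_neg_distrib, mul_assoc]
    rw [Finset.sum_comm, Finset.sum_comm (s := (Finset.univ : Finset (Fin n)))]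
  have hdiag : ∀ i, ∑ k, w k * B k i i = 0 := by
    intro i
    simpa [Pi.single_apply] using hw' (Pi.single i 1, 0) (by simp)
  have hcol : ∀ i : Fin n, y.2 i ≠ 0 → ∑ k, w k * B k i.succ 0 = 0 := by
    intro i hi
    simpa [Pi.single_apply] using hw' (0, Pi.single i 1) fun j hj => by
      refine Pi.single_eq_of_ne ?_ _
      rintro rfl
      exact hi hj
  -- Compare the diagonal entries of `A * B k = B k * A`. This transfers the vanishing from column
  -- `0` to row `0`, including the places where `y.2 i = 0` and `hcol` says nothing.
  have hop : ∀ (k) (i : Fin n), B k 0 i.succ = B k i.succ 0 * y.2 i := by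
    intro k i
    have h1 := congrFun (congrFun ((hAB k).trans (hBA k).symm) i.succ) i.succ
    simp only [Matrix.mul_apply, Fin.sum_univ_succ, hA, arrowMatrix_succ_zero,
      arrowMatrix_zero_succ, arrowMatrix_succ_succ] at h1
    simp at h1
    linarith
  have hrow : ∀ j, ∑ k, w k * B k 0 j = 0 := by
    intro j
    cases j using Fin.cases with
    | zero => exact hdiag 0
    | succ i =>
      simp only [hop, ← mul_assoc, ← Finset.sum_mul]
      by_cases hi : y.2 i = 0
      · rw [hi, mul_zero]
      · rw [hcol i hi, zero_mul]
  -- Row `0` of each `B k` is a left eigenvector of `A` for `lam k`, or zero, so the vanishing sum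
  -- vanishes term by term.
  have hrow' : ∀ k j, w k * B k 0 j = 0 := by
    intro k j
    refine congrFun (Matrix.eq_zero_of_sum_vecMul_eq_smul (A := A) hlam
      (r := fun k j => w k * B k 0 j) ?_ ?_ k) j
    · intro k
      ext j
      have := congrFun (congrFun (hBA k) 0) j
      simp only [Matrix.mul_apply, Matrix.smul_apply, smul_eq_mul] at this
      simp only [Matrix.vecMul, dotProduct, Pi.smul_apply, smul_eq_mul, mul_assoc,
        ← Finset.mul_sum, this]
      ring
    · ext j
      simpa using hrow j
  by_contra hne
  obtain ⟨k, hk⟩ := Function.ne_iff.1 hne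
  have hk0 : w k ≠ 0 := hk
  have hz : ∀ l, w l ≠ 0 → ∀ i : Fin n, (lam l - y.1 i.succ) * B l i.succ i.succ = 0 := by
    intro l hl i
    have h1 := congrFun (congrFun (hAB l) i.succ) i.succ
    have h2 := (mul_eq_zero.1 (hrow' l i.succ)).resolve_left hl
    simp only [Matrix.mul_apply, Fin.sum_univ_succ, hA, arrowMatrix_succ_zero,
      arrowMatrix_succ_succ] at h1
    simp [h2] at h1
    rcases h1 with h1 | h1
    · rw [h1, sub_self, zero_mul]
    · rw [h1, mul_zero]
  -- Some diagonal entry of `B k` is nonzero, necessarily away from the corner. By `hz` the diagonal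
  -- entry of `A` there is `lam k`, so only the term `k` survives in `hdiag`, a contradiction.
  obtain ⟨i, -, hi⟩ := Finset.exists_ne_zero_of_sum_ne_zero (htr k)
  rw [Matrix.diag_apply] at hi
  cases i using Fin.cases with
  | zero => exact hi ((mul_eq_zero.1 (hrow' k 0)).resolve_left hk0)
  | succ i =>
    have h1 := (mul_eq_zero.1 (hz k hk0 i)).resolve_right hi
    have h2 := hdiag i.succ
    rw [Finset.sum_eq_single k] at h2
    · exact (mul_ne_zero hk0 hi) h2
    · intro l _ hl
      by_cases hwl : w l = 0
      · rw [hwl, zero_mul]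
      · rw [(mul_eq_zero.1 (hz l hwl i)).resolve_left fun h3 => hl (hlam (by linarith)), mul_zero]
    · simp

/-- The differential of `charValues lam`, together with the coordinates of `y.2` that vanish at
`y`, can be completed to a linear coordinate system. -/
theorem exists_ker_fderiv_charValues_prod_eq_bot {n : ℕ} {lam : Fin (n + 1) → ℝ}
    (hlam : Function.Injective lam) {y : (Fin (n + 1) → ℝ) × (Fin n → ℝ)}
    (hy : charValues lam y = 0) :
    ∃ ρ : ((Fin (n + 1) → ℝ) × (Fin n → ℝ)) →ₗ[ℝ] (Fin n → ℝ),
      (∀ i, y.2 i = 0 → ∀ v, ρ v i = v.2 i) ∧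
      LinearMap.ker ((fderiv ℝ (charValues lam) y).toLinearMap.prod ρ) = ⊥ := by
  let Z := {i : Fin n // y.2 i = 0}
  let Zc := {i : Fin n // y.2 i ≠ 0}
  let f : ((Fin (n + 1) → ℝ) × (Fin n → ℝ)) →ₗ[ℝ] (Fin (n + 1) → ℝ) × (Z → ℝ) :=
    (fderiv ℝ (charValues lam) y).toLinearMap.prod
      ((LinearMap.funLeft ℝ ℝ ((↑) : Z → Fin n)).comp (LinearMap.snd ℝ _ _))
  have hf1 : ∀ v, (f v).1 = fderiv ℝ (charValues lam) y v := fun v => rfl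
  have hf2 : ∀ v (i : Z), (f v).2 i = v.2 i := fun v i => rfl
  have hsurj : LinearMap.range f = ⊤ := by
    by_contra hne
    obtain ⟨g, hg0, hg⟩ := Submodule.exists_le_ker_of_lt_top _ (lt_top_iff_ne_top.2 hne)
    have hg1 : ∀ a, g (a, 0) = ∑ k, g (Pi.single k 1, 0) * a k := by
      intro a
      have := (g.comp (LinearMap.inl ℝ (Fin (n + 1) → ℝ) (Z → ℝ))).pi_apply_eq_sum_univ a
      refine this.trans (Finset.sum_congr rfl fun k _ => ?_)
      rw [smul_eq_mul, mul_comm, show (fun j => if k = j then (1 : ℝ) else 0) = Pi.single k 1 from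
        funext fun j => by simp [Pi.single_apply, eq_comm]]
      rfl
    have hgf : ∀ v, g (f v) = 0 := fun v => hg (LinearMap.mem_range_self f v)
    have hw := eq_zero_of_sum_fderiv_charValues hlam hy (w := fun k => g (Pi.single k 1, 0)) (by
      intro v hv
      have h2 : f v = (fderiv ℝ (charValues lam) y v, 0) :=
        Prod.ext rfl (funext fun i => (hf2 v i).trans (hv i i.2))
      rw [← hg1, ← h2, hgf])
    have hg2 : ∀ a, g (a, 0) = 0 := by
      intro a
      rw [hg1]
      exact Finset.sum_eq_zero fun k _ => by rw [show g (Pi.single k 1, 0) = 0 from congrFun hw k,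
        zero_mul]
    refine hg0 (LinearMap.ext fun p => ?_)
    -- Any values on the vanishing coordinates are realized by some `v`; the error in the first
    -- component is killed by `g`.
    let v : (Fin (n + 1) → ℝ) × (Fin n → ℝ) :=
      (0, fun i => if h : y.2 i = 0 then p.2 ⟨i, h⟩ else 0)
    have h3 : p = (p.1 - (f v).1, 0) + f v := by
      refine Prod.ext (by simp) (funext fun i => ?_)
      have : (f v).2 i = p.2 i := by
        rw [hf2]
        simp [v, i.2]
      simp [this]
    rw [h3, map_add, hg2, hgf, add_zero, LinearMap.zero_apply]
  have hdim : Module.finrank ℝ (LinearMap.ker f) = Module.finrank ℝ (Zc → ℝ) := by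
    have h1 := LinearMap.finrank_range_add_finrank_ker f
    rw [hsurj, finrank_top] at h1
    simp only [Module.finrank_prod, Module.finrank_fintype_fun_eq_card, Fintype.card_fin] at h1 ⊢
    have h2 : Fintype.card Zc = Fintype.card (Fin n) - Fintype.card Z :=
      Fintype.card_subtype_compl _
    have h3 : Fintype.card Z ≤ Fintype.card (Fin n) := Fintype.card_subtype_le _
    rw [Fintype.card_fin] at h2 h3
    omega
  let τ : LinearMap.ker f ≃ₗ[ℝ] (Zc → ℝ) := LinearEquiv.ofFinrankEq _ _ hdim
  obtain ⟨q, hq⟩ := LinearMap.exists_leftInverse_of_injective (LinearMap.ker f).subtype (by simp)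
  -- The slots with `y.2 i ≠ 0` are filled with linear coordinates `τ` on `ker f`, extended by the
  -- projection `q`; the dimensions match.
  refine ⟨LinearMap.pi fun i => if h : y.2 i = 0 then (LinearMap.proj i).comp (LinearMap.snd ℝ _ _)
    else (LinearMap.proj ⟨i, h⟩).comp (τ.toLinearMap.comp q), ?_, ?_⟩
  · intro i hi v
    simp [hi]
  · rw [LinearMap.ker_eq_bot']
    intro v hv
    obtain ⟨hv1, hv2⟩ := Prod.ext_iff.1 hv
    have hvf : v ∈ LinearMap.ker f := by
      refine Prod.ext hv1 (funext fun i => ?_)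
      have := congrFun hv2 i
      simp [i.2] at this
      exact this
    have hqv : q v = ⟨v, hvf⟩ := LinearMap.congr_fun hq ⟨v, hvf⟩
    have hτ : τ ⟨v, hvf⟩ = 0 := by
      ext i
      have := congrFun hv2 i
      simp [i.2, hqv] at this
      exact this
    rw [LinearEquiv.map_eq_zero_iff] at hτ
    exact congrArg Subtype.val hτ

/-- Near a solution `y` of `charValues lam y = 0` there are smooth coordinates which consist of
`charValues lam`, of the coordinates of `y.2` that vanish at `y`, and of positive functions. -/
theorem exists_coordinates_charValues {n : ℕ} {lam : Fin (n + 1) → ℝ}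
    (hlam : Function.Injective lam) {y : (Fin (n + 1) → ℝ) × (Fin n → ℝ)}
    (hy : charValues lam y = 0) (hy0 : ∀ i, 0 ≤ y.2 i) :
    ∃ e : OpenPartialHomeomorph ((Fin (n + 1) → ℝ) × (Fin n → ℝ))
        ((Fin (n + 1) → ℝ) × (Fin n → ℝ)),
      y ∈ e.source ∧ ContDiffOn ℝ ∞ e e.source ∧ ContDiffOn ℝ ∞ e.symm e.target ∧
      ∀ z ∈ e.source, (e z).1 = charValues lam z ∧
        ∀ i, (y.2 i = 0 → (e z).2 i = z.2 i) ∧ (y.2 i ≠ 0 → 0 < z.2 i ∧ 0 < (e z).2 i) := by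
  obtain ⟨ρ, hρ, hker⟩ := exists_ker_fderiv_charValues_prod_eq_bot hlam hy
  let ρ' := LinearMap.toContinuousLinearMap ρ
  -- The shift makes the free coordinates equal to `1` at `y`, hence positive nearby, and leaves the
  -- vanishing ones unshifted.
  let κ : Fin n → ℝ := fun i => if y.2 i = 0 then 0 else 1
  let R : (Fin (n + 1) → ℝ) × (Fin n → ℝ) → Fin n → ℝ := fun z => ρ' (z - y) + κ
  have hRs : ContDiff ℝ ∞ R := by fun_prop
  let L : ((Fin (n + 1) → ℝ) × (Fin n → ℝ)) ≃L[ℝ] ((Fin (n + 1) → ℝ) × (Fin n → ℝ)) :=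
    (LinearEquiv.ofInjectiveEndo _ (LinearMap.ker_eq_bot.1 hker)).toContinuousLinearEquiv
  have hL : HasFDerivAt (fun z => (charValues lam z, R z)) (L : _ →L[ℝ] _) y := by
    have h1 : HasFDerivAt R ρ' y :=
      (ρ'.hasFDerivAt.comp y ((hasFDerivAt_id y).sub_const y)).add_const κ
    exact ((contDiff_charValues lam).differentiable (by simp) y).hasFDerivAt.prodMk h1
  let U := {z : (Fin (n + 1) → ℝ) × (Fin n → ℝ) | ∀ i, y.2 i ≠ 0 → 0 < z.2 i ∧ 0 < R z i}
  have hU : IsOpen U := by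
    simp only [U, Set.ofPred_forall]
    refine isOpen_iInter_of_finite fun i => isOpen_iInter_of_finite fun _ => ?_
    exact (isOpen_lt continuous_const ((continuous_apply i).comp continuous_snd)).inter
      (isOpen_lt continuous_const ((continuous_apply i).comp hRs.continuous))
  obtain ⟨e, he1, he2, he3, he4, he5⟩ := exists_openPartialHomeomorph_of_contDiffOn hU
    ((contDiff_charValues lam).prodMk hRs).contDiffOn (p := y)
    (fun i hi => ⟨lt_of_le_of_ne (hy0 i) (Ne.symm hi), by simp [R, κ, hi]⟩) hL
  refine ⟨e, he1, he4, he5, fun z hz => ?_⟩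
  rw [he3]
  refine ⟨rfl, fun i => ⟨fun hi => ?_, he2 hz i⟩⟩
  change ρ (z - y) i + κ i = z.2 i
  simp [hρ i hi, κ, hi]

/-! ### Hermitian arrow matrices and their torus invariants. -/

theorem RCLike.contDiff_normSq {𝕜 : Type*} [RCLike 𝕜] {m : WithTop ℕ∞} :
    ContDiff ℝ m (fun z : 𝕜 => RCLike.normSq z) := by
  simp only [RCLike.normSq_apply]
  have h1 : ContDiff ℝ m (RCLike.re : 𝕜 → ℝ) := (RCLike.reCLM (K := 𝕜)).contDiff
  have h2 : ContDiff ℝ m (RCLike.im : 𝕜 → ℝ) := (RCLike.imCLM (K := 𝕜)).contDiff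
  exact (h1.mul h1).add (h2.mul h2)

/-- The diagonal of a matrix, and the squared moduli of the remaining entries of the first row. -/
def arrowInvariants {𝕜 : Type*} [RCLike 𝕜] {n : ℕ} (A : Fin (n + 1) → Fin (n + 1) → 𝕜) :
    (Fin (n + 1) → ℝ) × (Fin n → ℝ) :=
  (fun i => RCLike.re (A i i), fun i => RCLike.normSq (A 0 i.succ))

theorem contDiff_arrowInvariants {𝕜 : Type*} [RCLike 𝕜] {n : ℕ} :
    ContDiff ℝ ∞ (arrowInvariants (𝕜 := 𝕜) (n := n)) := by
  refine ContDiff.prodMk (contDiff_pi.2 fun i => ?_) (contDiff_pi.2 fun i => ?_)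
  · exact (RCLike.reCLM (K := 𝕜)).contDiff.comp (contDiff_apply_apply ℝ 𝕜 i i)
  · exact RCLike.contDiff_normSq.comp (contDiff_apply_apply ℝ 𝕜 0 i.succ)

/-- The Hermitian arrow matrix with real diagonal `d` and first row `b` outside the corner. -/
def hermitianArrow {𝕜 : Type*} [RCLike 𝕜] {n : ℕ} (d : Fin (n + 1) → ℝ) (b : Fin n → 𝕜) :
    Matrix (Fin (n + 1)) (Fin (n + 1)) 𝕜 :=
  arrowMatrix (fun i => (d i : 𝕜)) b (star b)

/-- Moving `star b` from the first column to the first row leaves the determinant unchanged and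
makes the matrix real. -/
theorem det_scalar_sub_hermitianArrow {𝕜 : Type*} [RCLike 𝕜] {n : ℕ} (lam : Fin (n + 1) → ℝ)
    (d : Fin (n + 1) → ℝ) (b : Fin n → 𝕜) (k : Fin (n + 1)) :
    (Matrix.scalar (Fin (n + 1)) (lam k : 𝕜) - hermitianArrow d b).det =
      (charValues lam (d, fun i => RCLike.normSq (b i)) k : 𝕜) := by
  have h1 := det_arrowMatrix_mul (fun i => (lam k : 𝕜) - (d i : 𝕜)) (-b) (-1) (star b)
  have h2 : star b * -1 = -star b := by ext; simp
  rw [hermitianArrow, scalar_sub_arrowMatrix, ← h2, ← h1, charValues, scalar_sub_arrowMatrix]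
  change _ = algebraMap ℝ 𝕜 _
  rw [RingHom.map_det]
  congr 1
  ext i j
  cases i using Fin.cases <;> cases j using Fin.cases <;>
    simp [RCLike.normSq_eq_def', RCLike.mul_conj]
  split_ifs <;> simp

section

variable {𝕜 : Type*} [RCLike 𝕜] {n : ℕ} {lam : Fin (n + 1) → ℝ}

theorem isHermitian_hermitianArrow (d : Fin (n + 1) → ℝ) (b : Fin n → 𝕜) :
    (hermitianArrow d b).IsHermitian := by
  ext i j
  cases i using Fin.cases <;> cases j using Fin.cases <;>
    simp [hermitianArrow, Matrix.conjTranspose_apply]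
  rename_i i j
  by_cases h : i = j
  · simp [h]
  · simp [h, Ne.symm h]

theorem eq_hermitianArrow (A : isospectralArrow 𝕜 lam) :
    A.1 = hermitianArrow (arrowInvariants (isospectralArrow.entries A)).1 fun i => A.1 0 i.succ := by
  rw [eq_arrowMatrix A.2.2.1]
  have h1 : ∀ i j, star (A.1 j i) = A.1 i j := A.2.1.apply
  ext i j
  cases i using Fin.cases <;> cases j using Fin.cases <;>
    simp [hermitianArrow, arrowInvariants, isospectralArrow.entries]
  · exact (RCLike.conj_eq_iff_re.1 (h1 0 0)).symm
  · exact (h1 _ _).symm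
  · rw [RCLike.conj_eq_iff_re.1 (h1 _ _)]

theorem hermitianArrow_mem_isospectralArrow_iff (hlam : Function.Injective lam)
    (d : Fin (n + 1) → ℝ) (b : Fin n → 𝕜) :
    hermitianArrow d b ∈ isospectralArrow 𝕜 lam ↔
      charValues lam (d, fun i => RCLike.normSq (b i)) = 0 := by
  have h1 : Function.Injective fun i => (lam i : 𝕜) := RCLike.ofReal_injective.comp hlam
  have h2 := Matrix.spectrum_eq_range_iff (A := hermitianArrow d b) h1
  simp only [det_scalar_sub_hermitianArrow, RCLike.ofReal_eq_zero] at h2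
  constructor
  · exact fun h => funext (h2.1 h.2.2)
  · exact fun h => ⟨isHermitian_hermitianArrow d b,
      fun i j hij hi hj => arrowMatrix_eq_zero _ _ _ hij hi hj, h2.2 (congrFun h)⟩

theorem charValues_arrowInvariants (hlam : Function.Injective lam) (A : isospectralArrow 𝕜 lam) :
    charValues lam (arrowInvariants (isospectralArrow.entries A)) = 0 := by
  have h := A.2
  rw [eq_hermitianArrow A] at h
  exact (hermitianArrow_mem_isospectralArrow_iff hlam _ _).1 h

theorem arrowInvariants_hermitianArrow (d : Fin (n + 1) → ℝ) (b : Fin n → 𝕜) :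
    arrowInvariants (fun i j => hermitianArrow d b i j) = (d, fun i => RCLike.normSq (b i)) := by
  refine Prod.ext (funext fun i => ?_) rfl
  simp [arrowInvariants, hermitianArrow, arrowMatrix_self]

theorem contDiffOn_hermitianArrow {E : Type*} [NormedAddCommGroup E] [NormedSpace ℝ E] {s : Set E}
    {d : E → Fin (n + 1) → ℝ} {b : E → Fin n → 𝕜} (hd : ContDiffOn ℝ ∞ d s)
    (hb : ContDiffOn ℝ ∞ b s) :
    ContDiffOn ℝ ∞ (fun x i j => hermitianArrow (d x) (b x) i j) s := by
  have hd' : ∀ i, ContDiffOn ℝ ∞ (fun x => (d x i : 𝕜)) s := fun i =>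
    (RCLike.ofRealCLM (K := 𝕜)).contDiff.comp_contDiffOn (contDiffOn_pi.1 hd i)
  have hb' := contDiffOn_pi.1 hb
  refine contDiffOn_pi.2 fun i => contDiffOn_pi.2 fun j => ?_
  cases i using Fin.cases <;> cases j using Fin.cases <;>
    simp only [hermitianArrow, arrowMatrix_zero_zero, arrowMatrix_zero_succ,
      arrowMatrix_succ_zero, arrowMatrix_succ_succ]
  · exact hd' 0
  · exact hb' _
  · exact (RCLike.conjCLE (K := 𝕜)).contDiff.comp_contDiffOn (hb' _)
  · split_ifs
    · exact hd' _
    · exact contDiffOn_const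

theorem arrowInvariants_smul (t : Fin (n + 1) → unitary 𝕜) (A : isospectralArrow 𝕜 lam) :
    arrowInvariants (isospectralArrow.entries ((t : ReducedTorus 𝕜 n) • A)) =
      arrowInvariants (isospectralArrow.entries A) := by
  have h0 : ∀ u : unitary 𝕜, (u : 𝕜) * ((u⁻¹ : unitary 𝕜) : 𝕜) = 1 := fun u => by
    rw [← Submonoid.coe_mul, mul_inv_cancel, Submonoid.coe_one]
  have h1 : ∀ u : unitary 𝕜, RCLike.normSq (u : 𝕜) = 1 := fun u => by
    rw [RCLike.normSq_eq_def', CStarRing.norm_of_mem_unitary u.2, one_pow]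
  refine Prod.ext (funext fun i => ?_) (funext fun i => ?_)
  · simp only [arrowInvariants, isospectralArrow.entries, isospectralArrow.coe_mk_smul_apply]
    rw [mul_right_comm, h0, one_mul]
  · simp only [arrowInvariants, isospectralArrow.entries, isospectralArrow.coe_mk_smul_apply,
      map_mul, h1, one_mul, mul_one]

end

/-! ### Changing moduli while keeping phases. -/

theorem RCLike.normSq_sqrt_div_mul {𝕜 : Type*} [RCLike 𝕜] {a : ℝ} {z : 𝕜} (ha : 0 ≤ a)
    (hz : z ≠ 0) : RCLike.normSq ((√(a / RCLike.normSq z) : 𝕜) * z) = a := by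
  have hz' : RCLike.normSq z ≠ 0 := by simpa using hz
  rw [map_mul, RCLike.normSq_apply (√(a / RCLike.normSq z) : 𝕜), RCLike.ofReal_re,
    RCLike.ofReal_im, mul_zero, add_zero,
    Real.mul_self_sqrt (div_nonneg ha (RCLike.normSq_nonneg z)), div_mul_cancel₀ _ hz']

theorem RCLike.sqrt_div_mul_sqrt_div_mul {𝕜 : Type*} [RCLike 𝕜] {a : ℝ} {z : 𝕜} (ha : 0 < a)
    (hz : z ≠ 0) :
    (√(RCLike.normSq z / a) : 𝕜) * ((√(a / RCLike.normSq z) : 𝕜) * z) = z := by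
  have hz' : 0 < RCLike.normSq z :=
    lt_of_le_of_ne (RCLike.normSq_nonneg z) (Ne.symm (by simpa using hz))
  rw [← mul_assoc, ← RCLike.ofReal_mul, ← Real.sqrt_mul (by positivity)]
  have : RCLike.normSq z / a * (a / RCLike.normSq z) = 1 := by field_simp
  rw [this, Real.sqrt_one, RCLike.ofReal_one, one_mul]

/-- The rescaling of the coordinates of `z` outside of the set `p` to squared modulus `c`. -/
noncomputable def rescale {𝕜 : Type*} [RCLike 𝕜] {n : ℕ} (p : Fin n → Prop) [DecidablePred p]
    (c : Fin n → ℝ) (z : Fin n → 𝕜) : Fin n → 𝕜 :=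
  fun i => if p i then z i else (√(c i / RCLike.normSq (z i)) : 𝕜) * z i

section rescale

variable {𝕜 : Type*} [RCLike 𝕜] {n : ℕ} {p : Fin n → Prop} [DecidablePred p]

theorem normSq_rescale {c : Fin n → ℝ} {z : Fin n → 𝕜}
    (h1 : ∀ i, p i → c i = RCLike.normSq (z i)) (h2 : ∀ i, ¬ p i → 0 < c i ∧ z i ≠ 0) (i : Fin n) :
    RCLike.normSq (rescale p c z i) = c i := by
  unfold rescale
  split_ifs with h
  · exact (h1 i h).symm
  · exact RCLike.normSq_sqrt_div_mul (h2 i h).1.le (h2 i h).2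

/-- Makes the two directions of the chart mutually inverse: phases survive the first rescaling, so
restoring the old moduli recovers `z`. -/
theorem rescale_rescale {c c' : Fin n → ℝ} {z : Fin n → 𝕜}
    (h : ∀ i, ¬ p i → 0 < c i ∧ z i ≠ 0) (hc' : ∀ i, c' i = RCLike.normSq (z i)) :
    rescale p c' (rescale p c z) = z := by
  ext i
  unfold rescale
  split_ifs with hi
  · rfl
  · rw [RCLike.normSq_sqrt_div_mul (h i hi).1.le (h i hi).2, hc',
      RCLike.sqrt_div_mul_sqrt_div_mul (h i hi).1 (h i hi).2]

theorem rescale_mul {c : Fin n → ℝ} {z : Fin n → 𝕜} {s : Fin n → 𝕜}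
    (hs : ∀ i, RCLike.normSq (s i) = 1) (i : Fin n) :
    rescale p c (fun i => s i * z i) i = s i * rescale p c z i := by
  simp only [rescale, map_mul, hs, one_mul]
  split_ifs
  · rfl
  · ring

theorem contDiffOn_rescale {E : Type*} [NormedAddCommGroup E] [NormedSpace ℝ E] {s : Set E}
    {c : E → Fin n → ℝ} {z : E → Fin n → 𝕜} (hc : ContDiffOn ℝ ∞ c s) (hz : ContDiffOn ℝ ∞ z s)
    (h : ∀ x ∈ s, ∀ i, ¬ p i → 0 < c x i ∧ z x i ≠ 0) :
    ContDiffOn ℝ ∞ (fun x => rescale p (c x) (z x)) s := by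
  refine contDiffOn_pi.2 fun i => ?_
  have hzi := contDiffOn_pi.1 hz i
  unfold rescale
  split_ifs with hi
  · exact hzi
  · have h0 : ∀ x ∈ s, RCLike.normSq (z x i) ≠ 0 := fun x hx => by simpa using (h x hx i hi).2
    have h1 : ContDiffOn ℝ ∞ (fun x => √(c x i / RCLike.normSq (z x i))) s :=
      ((contDiffOn_pi.1 hc i).div (RCLike.contDiff_normSq.comp_contDiffOn hzi) h0).sqrt
        fun x hx => div_ne_zero (h x hx i hi).1.ne' (h0 x hx)
    exact ((RCLike.ofRealCLM (K := 𝕜)).contDiff.comp_contDiffOn h1).mul hzi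

end rescale

/-! ### Equivariant charts. -/

theorem isospectralArrow.isEmbedding_entries (𝕜 : Type*) [RCLike 𝕜] {n : ℕ}
    (lam : Fin (n + 1) → ℝ) : Topology.IsEmbedding
      (isospectralArrow.entries : isospectralArrow 𝕜 lam → Fin (n + 1) → Fin (n + 1) → 𝕜) :=
  Topology.IsEmbedding.subtypeVal

/-- Equivariant smooth charts of the space of isospectral arrow matrices. -/
theorem exists_equivariant_chart {𝕜 : Type*} [RCLike 𝕜] {n : ℕ} {lam : Fin (n + 1) → ℝ}
    (hlam : Function.Injective lam) (A : isospectralArrow 𝕜 lam) :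
    ∃ (φ : OpenPartialHomeomorph (isospectralArrow 𝕜 lam) (Fin n → 𝕜))
      (Φ : (Fin (n + 1) → Fin (n + 1) → 𝕜) → Fin n → 𝕜)
      (U : Set (Fin (n + 1) → Fin (n + 1) → 𝕜)),
      A ∈ φ.source ∧ ContDiffOn ℝ ∞ (isospectralArrow.entries ∘ φ.symm) φ.target ∧
      IsOpen U ∧ ContDiffOn ℝ ∞ Φ U ∧ Set.MapsTo isospectralArrow.entries φ.source U ∧
      Set.EqOn φ (Φ ∘ isospectralArrow.entries) φ.source ∧
      (∀ t : Fin (n + 1) → unitary 𝕜, ∀ B ∈ φ.source, (t : ReducedTorus 𝕜 n) • B ∈ φ.source ∧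
        φ ((t : ReducedTorus 𝕜 n) • B) =
          fun i => ((t 0 * (t i.succ)⁻¹ : unitary 𝕜) : 𝕜) * φ B i) ∧
      ∀ s : Fin n → unitary 𝕜, ∀ v ∈ φ.target, (fun i => (s i : 𝕜) * v i) ∈ φ.target := by
  have hnorm : ∀ u : unitary 𝕜, RCLike.normSq (u : 𝕜) = 1 := fun u => by
    rw [RCLike.normSq_eq_def', CStarRing.norm_of_mem_unitary u.2, one_pow]
  set y := arrowInvariants (isospectralArrow.entries A)
  obtain ⟨e, hye, hes, hes', he⟩ := exists_coordinates_charValues hlam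
    (charValues_arrowInvariants hlam A) fun i => RCLike.normSq_nonneg _
  let p : Fin n → Prop := fun i => y.2 i = 0
  let U : Set (Fin (n + 1) → Fin (n + 1) → 𝕜) := arrowInvariants ⁻¹' e.source
  let Φ : (Fin (n + 1) → Fin (n + 1) → 𝕜) → Fin n → 𝕜 :=
    fun B => rescale p (e (arrowInvariants B)).2 fun i => B 0 i.succ
  -- The first component is `0` because `charValues` vanishes on isospectral matrices; thus `N v`
  -- gives the `e`-coordinates of the invariants of the matrix with chart value `v`.
  let N : (Fin n → 𝕜) → (Fin (n + 1) → ℝ) × (Fin n → ℝ) :=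
    fun v => (0, fun i => RCLike.normSq (v i))
  let Ψ : (Fin n → 𝕜) → Matrix (Fin (n + 1)) (Fin (n + 1)) 𝕜 :=
    fun v => hermitianArrow (e.symm (N v)).1 (rescale p (e.symm (N v)).2 v)
  have hNs : ContDiff ℝ ∞ N := contDiff_const.prodMk (contDiff_pi.2 fun i =>
    RCLike.contDiff_normSq.comp (contDiff_apply ℝ 𝕜 i))
  have hUo : IsOpen U := e.open_source.preimage contDiff_arrowInvariants.continuous
  have hV : IsOpen (N ⁻¹' e.target) := e.open_target.preimage hNs.continuous
  have hUpos : ∀ B ∈ U, ∀ i, ¬ p i → 0 < (e (arrowInvariants B)).2 i ∧ B 0 i.succ ≠ 0 := by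
    intro B hB i hi
    have h1 := ((he _ hB).2 i).2 hi
    refine ⟨h1.2, fun h2 => ?_⟩
    have h3 := h1.1
    simp [arrowInvariants, h2] at h3
  have hVpos : ∀ v ∈ N ⁻¹' e.target, ∀ i, ¬ p i → 0 < (e.symm (N v)).2 i ∧ v i ≠ 0 := by
    intro v hv i hi
    have h1 := ((he _ (e.map_target hv)).2 i).2 hi
    rw [e.right_inv hv] at h1
    refine ⟨h1.1, fun h2 => ?_⟩
    have h3 := h1.2
    simp [N, h2] at h3
  have hVp : ∀ v ∈ N ⁻¹' e.target, ∀ i, p i → (e.symm (N v)).2 i = RCLike.normSq (v i) := by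
    intro v hv i hi
    have h1 := ((he _ (e.map_target hv)).2 i).1 hi
    rw [e.right_inv hv] at h1
    exact h1.symm
  have hinv : ∀ v ∈ N ⁻¹' e.target, arrowInvariants (fun i j => Ψ v i j) = e.symm (N v) := by
    intro v hv
    rw [arrowInvariants_hermitianArrow]
    exact Prod.ext rfl (funext fun i => normSq_rescale (hVp v hv) (hVpos v hv) i)
  have hmem : ∀ v ∈ N ⁻¹' e.target, Ψ v ∈ isospectralArrow 𝕜 lam := by
    intro v hv
    rw [hermitianArrow_mem_isospectralArrow_iff hlam, ← arrowInvariants_hermitianArrow]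
    refine (congrArg _ (hinv v hv)).trans ?_
    rw [← (he _ (e.map_target hv)).1, e.right_inv hv]
  have hNΦ : ∀ B : isospectralArrow 𝕜 lam, isospectralArrow.entries B ∈ U →
      N (Φ (isospectralArrow.entries B)) = e (arrowInvariants (isospectralArrow.entries B)) := by
    intro B hB
    refine Prod.ext ?_ (funext fun i => ?_)
    · rw [(he _ hB).1, charValues_arrowInvariants hlam]
    · exact normSq_rescale (fun i hi => ((he _ hB).2 i).1 hi) (hUpos _ hB) i
  have hΦs : ContDiffOn ℝ ∞ Φ U := by
    refine contDiffOn_rescale (contDiff_snd.comp_contDiffOn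
      (hes.comp contDiff_arrowInvariants.contDiffOn (Set.mapsTo_preimage _ _)))
      (contDiff_pi.2 fun i : Fin n =>
        contDiff_apply_apply ℝ 𝕜 (0 : Fin (n + 1)) i.succ).contDiffOn hUpos
  have hΨs : ContDiffOn ℝ ∞ (fun v i j => Ψ v i j) (N ⁻¹' e.target) := by
    have h1 := hes'.comp hNs.contDiffOn (Set.mapsTo_preimage N e.target)
    exact contDiffOn_hermitianArrow (contDiff_fst.comp_contDiffOn h1)
      (contDiffOn_rescale (contDiff_snd.comp_contDiffOn h1) contDiffOn_id hVpos)
  classical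
  have hcont := (isospectralArrow.isEmbedding_entries 𝕜 lam).continuous
  obtain ⟨φ, hφ, hsrc, htgt, hsymm⟩ : ∃ φ : OpenPartialHomeomorph (isospectralArrow 𝕜 lam)
      (Fin n → 𝕜), (∀ B, φ B = Φ (isospectralArrow.entries B)) ∧
        φ.source = isospectralArrow.entries ⁻¹' U ∧ φ.target = N ⁻¹' e.target ∧
        ∀ v ∈ N ⁻¹' e.target, isospectralArrow.entries (φ.symm v) = fun i j => Ψ v i j := by
    refine ⟨{
      toFun := fun B => Φ (isospectralArrow.entries B)
      -- `A` is a junk value outside the target.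
      invFun := fun v => if hv : v ∈ N ⁻¹' e.target then ⟨Ψ v, hmem v hv⟩ else A
      source := isospectralArrow.entries ⁻¹' U
      target := N ⁻¹' e.target
      map_source' := by
        intro B hB
        rw [Set.mem_preimage, hNΦ B hB]
        exact e.map_source hB
      map_target' := by
        intro v hv
        rw [dif_pos hv]
        change arrowInvariants (fun i j => Ψ v i j) ∈ e.source
        rw [hinv v hv]
        exact e.map_target hv
      left_inv' := by
        intro B hB
        have h1 : Φ (isospectralArrow.entries B) ∈ N ⁻¹' e.target := by
          rw [Set.mem_preimage, hNΦ B hB]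
          exact e.map_source hB
        rw [dif_pos h1]
        refine Subtype.ext ?_
        rw [eq_hermitianArrow B]
        change hermitianArrow (e.symm (N (Φ (isospectralArrow.entries B)))).1 (rescale p
          (e.symm (N (Φ (isospectralArrow.entries B)))).2 (Φ (isospectralArrow.entries B))) = _
        rw [hNΦ B hB, e.left_inv hB]
        congr 1
        exact rescale_rescale (hUpos _ hB) fun i => rfl
      right_inv' := by
        intro v hv
        rw [dif_pos hv]
        change rescale p (e (arrowInvariants fun i j => Ψ v i j)).2
          (rescale p (e.symm (N v)).2 v) = v
        rw [hinv v hv, e.right_inv hv]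
        exact rescale_rescale (hVpos v hv) fun i => rfl
      open_source := hUo.preimage hcont
      open_target := hV
      continuousOn_toFun := hΦs.continuousOn.comp hcont.continuousOn
        (Set.mapsTo_preimage _ _)
      continuousOn_invFun := by
        rw [(isospectralArrow.isEmbedding_entries 𝕜 lam).isInducing.continuousOn_iff]
        refine hΨs.continuousOn.congr fun v hv => ?_
        simp only [Function.comp_apply, dif_pos hv]
        rfl }, fun B => rfl, rfl, rfl, fun v hv => ?_⟩
    change isospectralArrow.entries (if hv : v ∈ N ⁻¹' e.target then _ else A) = _
    rw [dif_pos hv]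
    rfl
  refine ⟨φ, Φ, U, by rw [hsrc]; exact hye, ?_, hUo, hΦs, ?_, fun B _ => hφ B, ?_, ?_⟩
  · rw [htgt]
    exact hΨs.congr hsymm
  · rw [hsrc]
    exact Set.mapsTo_preimage _ _
  · intro t B hB
    rw [hsrc] at hB ⊢
    have h1 := arrowInvariants_smul t B
    constructor
    · change arrowInvariants _ ∈ e.source
      rw [h1]
      exact hB
    · ext i
      rw [hφ, hφ]
      simp only [Φ]
      rw [h1, ← rescale_mul (s := fun i => ((t 0 * (t i.succ)⁻¹ : unitary 𝕜) : 𝕜))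
        fun i => hnorm _]
      congr 1
      ext j
      refine (isospectralArrow.coe_mk_smul_apply t B 0 j.succ).trans ?_
      rw [Submonoid.coe_mul, mul_right_comm]
      rfl
  · rw [htgt]
    intro s v hv
    have h2 : N (fun i => (s i : 𝕜) * v i) = N v := by simp [N, hnorm]
    rw [Set.mem_preimage, h2]
    exact hv

/-! ### The reduced torus and the conclusion. -/

/-- The quotient of `(unitary 𝕜) ^ (n + 1)` by the diagonal is isomorphic to `(unitary 𝕜) ^ n`, the
class of `t` corresponding to the ratios `t 0 / t i`. -/
theorem exists_reducedTorus_continuousMulEquiv (𝕜 : Type*) [RCLike 𝕜] (n : ℕ) :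
    ∃ ψ : ReducedTorus 𝕜 n ≃ₜ* (Fin n → unitary 𝕜),
      ∀ (t : Fin (n + 1) → unitary 𝕜) (i : Fin n),
        ψ (t : ReducedTorus 𝕜 n) i = t 0 * (t i.succ)⁻¹ := by
  let f : (Fin (n + 1) → unitary 𝕜) →* (Fin n → unitary 𝕜) :=
    { toFun := fun t i => t 0 * (t i.succ)⁻¹
      map_one' := by ext; simp
      map_mul' := fun s t => by
        funext i
        simp only [Pi.mul_apply, mul_inv_rev]
        rw [mul_comm (t i.succ)⁻¹, mul_mul_mul_comm] }
  have hf : diagonalSubgroup 𝕜 n ≤ f.ker := by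
    rintro _ ⟨z, rfl⟩
    rw [MonoidHom.mem_ker]
    funext i
    exact mul_inv_cancel z
  -- The inverse picks the representative with `t 0 = 1`.
  refine ⟨{ toFun := QuotientGroup.lift (diagonalSubgroup 𝕜 n) f hf
            invFun := fun s =>
              ((Fin.cons 1 fun i => (s i)⁻¹ : Fin (n + 1) → unitary 𝕜) : ReducedTorus 𝕜 n)
            left_inv := ?_
            right_inv := ?_
            map_mul' := map_mul _
            continuous_toFun := ?_
            continuous_invFun := ?_ }, fun t i => rfl⟩
  · intro q
    obtain ⟨t, rfl⟩ := QuotientGroup.mk_surjective q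
    refine QuotientGroup.eq.2 ⟨t 0, ?_⟩
    funext i
    cases i using Fin.cases with
    | zero => simp
    | succ i =>
      change t 0 = ((t 0 * (t i.succ)⁻¹)⁻¹)⁻¹ * t i.succ
      rw [inv_inv, inv_mul_cancel_right]
  · intro s
    funext i
    change (1 : unitary 𝕜) * ((s i)⁻¹)⁻¹ = s i
    rw [inv_inv, one_mul]
  · refine continuous_quot_lift _ (continuous_pi fun i => ?_)
    exact (continuous_apply 0).mul (continuous_apply i.succ).inv
  · refine QuotientGroup.continuous_mk.comp (continuous_pi fun i => ?_)
    cases i using Fin.cases with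
    | zero => exact continuous_const
    | succ i => exact (continuous_apply i).inv

theorem isospectralArrow_isManifold_and_isLocallyStandard {𝕜 : Type} [RCLike 𝕜] {n m : ℕ}
    {lam : Fin (n + 1) → ℝ} (hlam : Function.Injective lam)
    (hm : Module.finrank ℝ (Fin n → 𝕜) = m) :
    ∃ _ : ChartedSpace (EuclideanSpace ℝ (Fin m)) (isospectralArrow 𝕜 lam),
      IsManifold (𝓡 m) ∞ (isospectralArrow 𝕜 lam) ∧
      Manifold.IsSmoothEmbedding (𝓡 m) 𝓘(ℝ, Fin (n + 1) → Fin (n + 1) → 𝕜) ∞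
        (isospectralArrow.entries : isospectralArrow 𝕜 lam → Fin (n + 1) → Fin (n + 1) → 𝕜) ∧
      IsLocallyStandard 𝕜 n (ReducedTorus 𝕜 n) (𝓡 m) (isospectralArrow 𝕜 lam) := by
  choose φ Φ U h1 h2 h3 h4 h5 h6 h7 h8 using
    exists_equivariant_chart (𝕜 := 𝕜) (lam := lam) hlam
  obtain ⟨inst, hman, himm, hφ⟩ :=
    exists_isSmoothEmbedding_of_charts
      (isospectralArrow.isEmbedding_entries 𝕜 lam) hm φ h1 h2 Φ U h3 h4 h5 h6
  obtain ⟨ψ, hψ⟩ := exists_reducedTorus_continuousMulEquiv 𝕜 n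
  refine ⟨inst, hman, himm, fun A => ⟨φ A, ψ, h1 A, ?_, h8 A, (hφ A).1, (hφ A).2, ?_⟩⟩
  · intro g B hB
    obtain ⟨t, rfl⟩ := QuotientGroup.mk_surjective g
    exact (h7 A t B hB).1
  · intro g B hB
    obtain ⟨t, rfl⟩ := QuotientGroup.mk_surjective g
    rw [(h7 A t B hB).2]
    simp only [hψ]

theorem mainTheorem1 (n : ℕ) (lam : Fin (n + 1) → ℝ) (hlam : StrictMono lam) :
    (∃ _ : ChartedSpace (EuclideanSpace ℝ (Fin (2 * n))) (isospectralArrow ℂ lam),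
      IsManifold (𝓡 (2 * n)) ∞ (isospectralArrow ℂ lam) ∧
      Manifold.IsSmoothEmbedding (𝓡 (2 * n)) 𝓘(ℝ, Fin (n + 1) → Fin (n + 1) → ℂ) ∞
        (isospectralArrow.entries : isospectralArrow ℂ lam → Fin (n + 1) → Fin (n + 1) → ℂ) ∧
      IsLocallyStandard ℂ n (ReducedTorus ℂ n) (𝓡 (2 * n)) (isospectralArrow ℂ lam)) ∧
    (∃ _ : ChartedSpace (EuclideanSpace ℝ (Fin n)) (isospectralArrow ℝ lam),
      IsManifold (𝓡 n) ∞ (isospectralArrow ℝ lam) ∧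
      Manifold.IsSmoothEmbedding (𝓡 n) 𝓘(ℝ, Fin (n + 1) → Fin (n + 1) → ℝ) ∞
        (isospectralArrow.entries : isospectralArrow ℝ lam → Fin (n + 1) → Fin (n + 1) → ℝ) ∧
      IsLocallyStandard ℝ n (ReducedTorus ℝ n) (𝓡 n) (isospectralArrow ℝ lam)) := by
  exact ⟨isospectralArrow_isManifold_and_isLocallyStandard hlam.injective
      (by simp [Module.finrank_pi_fintype, Complex.finrank_real_complex, mul_comm]),
    isospectralArrow_isManifold_and_isLocallyStandard hlam.injective (by simp)⟩
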